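/- Let $\nabla$ be the Alexander–Conway polynomial of oriented links, with values in $\mathbb C[s,s^{-1}]$: it is the isotopy invariant determined by $\nabla(\bigcirc)=1$ and the skein relation $\nabla(L_-)-(s^{-1}-s)\nabla(L_0)-\nabla(L_+)=0$. Fix the braid group $\mathcal B_n$ on $n\ge 1$ strands with Artin generators $x_1,\dots,x_{n-1}$ (each $x_i$ being a negative crossing), an integer $k\ge 0$ and a sequence $i_1,\dots,i_k\in\{1,\dots,n-1\}$. For $a\in\mathbb Z^k$ let $\nabla_n(x_{i_1}^{a_1}\cdots x_{i_k}^{a_k})$ be the Alexander–Conway polynomial of the closure of this $n$-braid. Put $q(\tau)=(1+s\tau)(1-s^{-1}\tau)$, $Q_0(\tau)=1-(s^{-1}-s)\tau$, $Q_1(\tau)=\tau$ and $$R(t_1,\dots,t_k)=q(t_1)^{-1}\cdots q(t_k)^{-1}\sum_{j\in\{0,1\}^k}Q_{j_1}(t_1)\cdots Q_{j_k}(t_k)\,\nabla_n(x_{i_1}^{j_1}\cdots x_{i_k}^{j_k}).$$ **Theorem.** The generating series is the rational function $R$: as formal power series over $\mathbb C[s,s^{-1}]$, in which the $q(t_i)$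 are invertible, $$\sum_{a\in\mathbb Z_{\ge 0}^k}\nabla_n(x_{i_1}^{a_1}\cdots x_{i_k}^{a_k})\,t_1^{a_1}\cdots t_k^{a_k}=R(t_1,\dots,t_k).$$ The remaining exponents $a\in\mathbb Z^k$ are governed by the same rational function: for every $S\subseteq\{1,\dots,k\}$, the sum of the terms $\nabla_n(x_{i_1}^{a_1}\cdots x_{i_k}^{a_k})\,t_1^{a_1}\cdots t_k^{a_k}$ over all $a\in\mathbb Z^k$ with $a_i<0$ for $i\in S$ and $a_i\ge 0$ for $i\notin S$ is $(-1)^{|S|}$ times the expansion of $R$ as a formal power series in $t_i^{-1}$ $(i\in S)$ and $t_i$ $(i\notin S)$. -/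

import Mathlib

namespace AlexanderConway

open scoped LaurentPolynomial

/-- The defining relators of the Artin braid group, in the generators indexed by `Fin m`:
`x_i x_{i+1} x_i = x_{i+1} x_i x_{i+1}`, and `x_i x_j = x_j x_i` for `|i - j| ≥ 2`. -/
def braidRels (m : ℕ) : Set (FreeGroup (Fin m)) :=
  {r | ∃ i j : Fin m, (i : ℕ) + 1 = j ∧
      r = (.of i * .of j * .of i) * (.of j * .of i * .of j)⁻¹} ∪
  {r | ∃ i j : Fin m, (i : ℕ) + 2 ≤ j ∧ r = (.of i * .of j) * (.of j * .of i)⁻¹}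

/-- The braid group on `N` strands (Artin's presentation, with `N - 1` generators). -/
def BraidGroup (N : ℕ) : Type := PresentedGroup (braidRels (N - 1))

noncomputable instance (N : ℕ) : Group (BraidGroup N) :=
  inferInstanceAs (Group (PresentedGroup (braidRels (N - 1))))

/-- The `n` Artin generators of the braid group on `n + 1` strands. -/
def x {n : ℕ} (i : Fin n) : BraidGroup (n + 1) :=
  PresentedGroup.of (rels := braidRels n) i

theorem x_braid {n : ℕ} (i j : Fin n) (h : (i : ℕ) + 1 = j) :
    x i * x j * x i = x j * x i * x j :=
  PresentedGroup.mk_eq_mk_of_mul_inv_mem (Or.inl ⟨i, j, h, rfl⟩)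

theorem x_comm {n : ℕ} (i j : Fin n) (h : (i : ℕ) + 2 ≤ j) : x i * x j = x j * x i :=
  PresentedGroup.mk_eq_mk_of_mul_inv_mem (Or.inr ⟨i, j, h, rfl⟩)

/-- A homomorphism out of the braid group, from elements that satisfy the braid relations. -/
noncomputable def lift {n : ℕ} {G : Type} [Group G] (f : Fin n → G)
    (h1 : ∀ i j : Fin n, (i : ℕ) + 1 = j → f i * f j * f i = f j * f i * f j)
    (h2 : ∀ i j : Fin n, (i : ℕ) + 2 ≤ j → f i * f j = f j * f i) : BraidGroup (n + 1) →* G :=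
  PresentedGroup.toGroup (rels := braidRels n) (f := f) (by
    rintro r (⟨i, j, h, rfl⟩ | ⟨i, j, h, rfl⟩)
    · simp only [map_mul, map_inv, FreeGroup.lift_apply_of]
      rw [h1 i j h, mul_inv_cancel]
    · simp only [map_mul, map_inv, FreeGroup.lift_apply_of]
      rw [h2 i j h, mul_inv_cancel])

theorem lift_x {n : ℕ} {G : Type} [Group G] (f : Fin n → G) (h1) (h2) (i : Fin n) :
    lift f h1 h2 (x i) = f i :=
  PresentedGroup.toGroup.of _

theorem hom_ext {n : ℕ} {G : Type} [Group G] {f g : BraidGroup (n + 1) →* G}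
    (h : ∀ i, f (x i) = g (x i)) : f = g :=
  PresentedGroup.ext (rels := braidRels n) h

theorem braid_induction {n : ℕ} (C : BraidGroup (n + 1) → Prop) (h1 : C 1)
    (hx : ∀ i b, C b → C (x i * b)) (hx' : ∀ i b, C b → C ((x i)⁻¹ * b)) (b) : C b := by
  have hb : b ∈ Subgroup.closure (Set.range (x (n := n))) := by
    have := PresentedGroup.closure_range_of (braidRels n)
    exact (this.symm ▸ Subgroup.mem_top _ :
      b ∈ Subgroup.closure (Set.range (PresentedGroup.of (rels := braidRels n))))
  refine Subgroup.closure_induction_left (p := fun b _ => C b) h1 ?_ ?_ hb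
  · rintro _ ⟨i, rfl⟩ b _ h
    exact hx i b h
  · rintro _ ⟨i, rfl⟩ b _ h
    exact hx' i b h

/-- The inclusion of braid groups that adds one more (last) straight strand. -/
noncomputable def addStrand {n : ℕ} : BraidGroup (n + 1) →* BraidGroup (n + 2) :=
  lift (fun i => x i.castSucc) (fun i j h => x_braid _ _ (by simpa using h))
    (fun i j h => x_comm _ _ (by simpa using h))

theorem addStrand_x {n : ℕ} (i : Fin n) : addStrand (x i) = x i.castSucc := lift_x _ _ _ i

/-- The two Markov moves on braids with at least one strand: conjugation (in the form
`a b ↔ b a`) and (positive or negative) stabilization. -/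
inductive MarkovMove : (Σ n : ℕ, BraidGroup (n + 1)) → (Σ n : ℕ, BraidGroup (n + 1)) → Prop
  | conj {n : ℕ} (a b : BraidGroup (n + 1)) : MarkovMove ⟨n, a * b⟩ ⟨n, b * a⟩
  | stab {n : ℕ} (b : BraidGroup (n + 1)) :
      MarkovMove ⟨n, b⟩ ⟨n + 1, addStrand b * x (Fin.last n)⟩
  | stab_inv {n : ℕ} (b : BraidGroup (n + 1)) :
      MarkovMove ⟨n, b⟩ ⟨n + 1, addStrand b * (x (Fin.last n))⁻¹⟩

/-- Isotopy classes of (nonempty) oriented links in 3-space, presented as closed braids: every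
oriented link is the closure of a braid (Alexander), and two braids have isotopic closures exactly
if they are joined by a chain of Markov moves and their inverses (Markov). -/
def OrientedLink : Type := Quot MarkovMove

/-- The closure of a braid, as an oriented link. -/
def closure {n : ℕ} (b : BraidGroup (n + 1)) : OrientedLink := Quot.mk _ ⟨n, b⟩

/-- The unknot, the closure of the braid with one strand. -/
noncomputable def unknot : OrientedLink := closure (1 : BraidGroup 1)

/-- The variable `s` of the ring of Laurent polynomials `ℂ[s, s⁻¹]`. -/
noncomputable def s : ℂ[T;T⁻¹] := LaurentPolynomial.T 1

/-- The inverse `s⁻¹` of the variable. -/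
noncomputable def sInv : ℂ[T;T⁻¹] := LaurentPolynomial.T (-1)

theorem s_mul_sInv : s * sInv = 1 := by
  rw [s, sInv, ← LaurentPolynomial.T_add]; simp

/-- `F` is the Alexander-Conway polynomial: it is `1` on the unknot and satisfies the skein
relation `F(L₋) - (s⁻¹ - s) F(L₀) - F(L₊) = 0`. A skein triple is presented by closed braids
that differ in one crossing; the generator `x i` is a negative crossing, so that
`L₋`, `L₀`, `L₊` are the closures of `a (x i) b`, `a b`, `a (x i)⁻¹ b`. -/
structure IsAlexanderConway (F : OrientedLink → ℂ[T;T⁻¹]) : Prop where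
  unknot : F unknot = 1
  skein : ∀ {n : ℕ} (i : Fin n) (a b : BraidGroup (n + 1)),
    F (closure (a * x i * b)) - (sInv - s) * F (closure (a * b))
      - F (closure (a * (x i)⁻¹ * b)) = 0

/-! ### Uniqueness -/

theorem addStrand_addStrand_comm {n : ℕ} (c : BraidGroup (n + 1)) :
    x (Fin.last (n + 1)) * addStrand (addStrand c)
      = addStrand (addStrand c) * x (Fin.last (n + 1)) := by
  induction c using braid_induction with
  | h1 => simp
  | hx i b hb =>
    rw [map_mul, map_mul, addStrand_x, addStrand_x, ← mul_assoc, ← x_comm, mul_assoc, hb,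
      mul_assoc]
    simp
  | hx' i b hb =>
    have h : x i.castSucc.castSucc * x (Fin.last (n + 1)) = x (Fin.last (n + 1)) *
        x i.castSucc.castSucc := x_comm _ _ (by simp)
    have h' : Commute (x (Fin.last (n + 1))) (x i.castSucc.castSucc)⁻¹ :=
      (Commute.inv_right (show Commute _ _ from h.symm))
    rw [map_mul, map_mul, map_inv, map_inv, addStrand_x, addStrand_x, ← mul_assoc, h'.eq,
      mul_assoc, hb, mul_assoc]

/-- A function on a braid group that satisfies the skein relation. -/
def IsSkein {n : ℕ} (f : BraidGroup (n + 1) → ℂ[T;T⁻¹]) : Prop :=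
  ∀ (i : Fin n) (a b : BraidGroup (n + 1)),
    f (a * x i * b) - (sInv - s) * f (a * b) - f (a * (x i)⁻¹ * b) = 0


theorem skein_step {n : ℕ} {f : BraidGroup (n + 1) → ℂ[T;T⁻¹]} (hf : IsSkein f) (i : Fin n)
    (a b : BraidGroup (n + 1)) (h0 : f (a * b) = 0) (h1 : f (a * x i * b) = 0) :
    f (a * (x i)⁻¹ * b) = 0 := by
  have := hf i a b
  rw [h0, h1] at this
  simpa using this

theorem skein_sq {n : ℕ} {f : BraidGroup (n + 1) → ℂ[T;T⁻¹]} (hf : IsSkein f) (i : Fin n)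
    (a b : BraidGroup (n + 1)) (h0 : f (a * b) = 0) (h1 : f (a * x i * b) = 0) :
    f (a * x i * x i * b) = 0 := by
  have := hf i (a * x i) b
  rw [mul_inv_cancel_right, h0, h1] at this
  simpa using this

theorem IsSkein.eq_zero_aux {n : ℕ}
    (key : ∀ f : BraidGroup (n + 2) → ℂ[T;T⁻¹], IsSkein f → (∀ a, f (addStrand a) = 0) →
      (∀ a b, f (addStrand a * x (Fin.last n) * addStrand b) = 0) →
      ∀ a b, f (x (Fin.last n) * addStrand a * x (Fin.last n) * addStrand b) = 0)
    (g : BraidGroup (n + 2)) :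
    ∀ f : BraidGroup (n + 2) → ℂ[T;T⁻¹], IsSkein f → (∀ a, f (addStrand a) = 0) →
    (∀ a b, f (addStrand a * x (Fin.last n) * addStrand b) = 0) → f g = 0 := by
  have hpos : ∀ (i : Fin (n + 1)) (f : BraidGroup (n + 2) → ℂ[T;T⁻¹]), IsSkein f →
      (∀ a, f (addStrand a) = 0) →
      (∀ a b, f (addStrand a * x (Fin.last n) * addStrand b) = 0) →
      (∀ a, f (x i * addStrand a) = 0) ∧
      (∀ a b, f (x i * (addStrand a * x (Fin.last n) * addStrand b)) = 0) := by
    intro i f hf h1 h2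
    induction i using Fin.lastCases with
    | last =>
      refine ⟨fun a => by simpa using h2 1 a, fun a b => ?_⟩
      simpa only [mul_assoc] using key f hf h1 h2 a b
    | cast i =>
      rw [← addStrand_x]
      refine ⟨fun a => by rw [← map_mul]; exact h1 _, fun a b => ?_⟩
      rw [← mul_assoc, ← mul_assoc, ← map_mul]
      exact h2 _ _
  have hneg : ∀ (i : Fin (n + 1)) (f : BraidGroup (n + 2) → ℂ[T;T⁻¹]), IsSkein f →
      (∀ a, f (addStrand a) = 0) →
      (∀ a b, f (addStrand a * x (Fin.last n) * addStrand b) = 0) →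
      (∀ a, f ((x i)⁻¹ * addStrand a) = 0) ∧
      (∀ a b, f ((x i)⁻¹ * (addStrand a * x (Fin.last n) * addStrand b)) = 0) := by
    intro i f hf h1 h2
    obtain ⟨h3, h4⟩ := hpos i f hf h1 h2
    refine ⟨fun a => ?_, fun a b => ?_⟩
    · simpa using skein_step hf i 1 (addStrand a) (by simpa using h1 a) (by simpa using h3 a)
    · simpa using skein_step hf i 1 (addStrand a * x (Fin.last n) * addStrand b)
        (by simpa using h2 a b) (by simpa using h4 a b)
  induction g using braid_induction with
  | h1 => intro f hf h1 h2; simpa using h1 1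
  | hx i b hb =>
    intro f hf h1 h2
    refine hb (fun c => f (x i * c)) (fun j c d => ?_) (hpos i f hf h1 h2).1 (hpos i f hf h1 h2).2
    simpa only [mul_assoc] using hf j (x i * c) d
  | hx' i b hb =>
    intro f hf h1 h2
    refine hb (fun c => f ((x i)⁻¹ * c)) (fun j c d => ?_) (hneg i f hf h1 h2).1
      (hneg i f hf h1 h2).2
    simpa only [mul_assoc] using hf j ((x i)⁻¹ * c) d

theorem braid_one (b : BraidGroup 1) : b = 1 := by
  induction b using braid_induction with
  | h1 => rfl
  | hx i => exact i.elim0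
  | hx' i => exact i.elim0

theorem IsSkein.eq_zero : ∀ {n : ℕ} (f : BraidGroup (n + 2) → ℂ[T;T⁻¹]), IsSkein f →
    (∀ a, f (addStrand a) = 0) →
    (∀ a b, f (addStrand a * x (Fin.last n) * addStrand b) = 0) → ∀ g, f g = 0 := by
  intro n
  induction n with
  | zero =>
    intro f hf h1 h2 g
    refine IsSkein.eq_zero_aux (fun f hf h1 h2 a b => ?_) g f hf h1 h2
    have := skein_sq hf (Fin.last 0) 1 (addStrand b) (by simpa using h1 b) (by simpa using h2 1 b)
    rw [braid_one a]
    simpa using this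
  | succ n ih =>
    intro f hf h1 h2 g
    refine IsSkein.eq_zero_aux (fun f hf h1 h2 a b => ?_) g f hf h1 h2
    refine ih (fun c => f (x (Fin.last (n + 1)) * addStrand c * x (Fin.last (n + 1)) * addStrand b))
      (fun j c d => ?_) (fun c => ?_) (fun c d => ?_) a
    · have := hf j.castSucc (x (Fin.last (n + 1)) * addStrand c)
        (addStrand d * x (Fin.last (n + 1)) * addStrand b)
      simpa only [map_mul, map_inv, addStrand_x, mul_assoc] using this
    · have := skein_sq hf (Fin.last (n + 1)) (addStrand (addStrand c)) (addStrand b)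
        (by rw [← map_mul]; exact h1 _) (h2 _ _)
      rw [addStrand_addStrand_comm]
      exact this
    · have hb : x (Fin.last n).castSucc * x (Fin.last (n + 1)) * x (Fin.last n).castSucc =
          x (Fin.last (n + 1)) * x (Fin.last n).castSucc * x (Fin.last (n + 1)) :=
        x_braid _ _ (by simp)
      have := h2 (addStrand c * x (Fin.last n)) (x (Fin.last n) * addStrand d * b)
      rw [← this]
      congr 1
      simp only [map_mul, addStrand_x]
      calc _ = (x (Fin.last (n + 1)) * addStrand (addStrand c)) * x (Fin.last n).castSucc *
            (addStrand (addStrand d) * x (Fin.last (n + 1))) * addStrand b := by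
              simp only [mul_assoc]
        _ = addStrand (addStrand c) * (x (Fin.last (n + 1)) * x (Fin.last n).castSucc *
            x (Fin.last (n + 1))) * addStrand (addStrand d) * addStrand b := by
              rw [addStrand_addStrand_comm, ← addStrand_addStrand_comm d]
              simp only [mul_assoc]
        _ = _ := by
              rw [← hb]
              simp only [mul_assoc]

theorem sInv_sub_s_ne_zero : sInv - s ≠ 0 := by
  intro h
  have := congrArg (fun p : ℂ[T;T⁻¹] => p.coeff 1) h
  simp [s, sInv] at this

theorem closure_stab {n : ℕ} (b : BraidGroup (n + 1)) :
    closure (addStrand b * x (Fin.last n)) = closure b := (Quot.sound (.stab b)).symm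

theorem closure_stab_inv {n : ℕ} (b : BraidGroup (n + 1)) :
    closure (addStrand b * (x (Fin.last n))⁻¹) = closure b := (Quot.sound (.stab_inv b)).symm

theorem closure_conj {n : ℕ} (a b : BraidGroup (n + 1)) : closure (a * b) = closure (b * a) :=
  Quot.sound (.conj a b)

/-- The Alexander-Conway polynomial is determined by its normalization and skein relation. -/
theorem IsAlexanderConway.unique {F G : OrientedLink → ℂ[T;T⁻¹]} (hF : IsAlexanderConway F)
    (hG : IsAlexanderConway G) : F = G := by
  have main : ∀ (n : ℕ) (b : BraidGroup (n + 1)), F (closure b) - G (closure b) = 0 := by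
    intro n
    induction n with
    | zero =>
      intro b
      rw [braid_one b]
      exact sub_eq_zero.2 (hF.unknot.trans hG.unknot.symm)
    | succ n ih =>
      refine IsSkein.eq_zero (fun b => F (closure b) - G (closure b)) (fun i a b => ?_)
        (fun a => ?_) (fun a b => ?_)
      · linear_combination hF.skein i a b - hG.skein i a b
      · have h1 := hF.skein (Fin.last n) (addStrand a) 1
        have h2 := hG.skein (Fin.last n) (addStrand a) 1
        simp only [mul_one, closure_stab, closure_stab_inv] at h1 h2
        refine (mul_eq_zero.1 (?_ : (sInv - s) * _ = 0)).resolve_left sInv_sub_s_ne_zero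
        linear_combination h2 - h1
      · show F (closure _) - G (closure _) = 0
        rw [closure_conj, ← mul_assoc, ← map_mul, closure_stab]
        exact ih _
  funext L
  induction L using Quot.inductionOn with
  | h L => exact sub_eq_zero.1 (main L.1 L.2)

/-! ### Existence, through the Burau representation -/

open Matrix

theorem sInv_mul_s : sInv * s = 1 := by rw [mul_comm, s_mul_sInv]

noncomputable def uV {n : ℕ} (i : Fin n) : Fin (n + 1) → ℂ[T;T⁻¹] :=
  Pi.single i.castSucc (s * s) - Pi.single i.succ 1

noncomputable def wV {n : ℕ} (i : Fin n) : Fin (n + 1) → ℂ[T;T⁻¹] :=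
  Pi.single i.castSucc 1 - Pi.single i.succ 1

theorem w_dot_u {n : ℕ} (i j : Fin n) : wV i ⬝ᵥ uV j =
    (if i = j then s * s else 0) - (if i.castSucc = j.succ then 1 else 0) -
      (if i.succ = j.castSucc then s * s else 0) + (if i = j then 1 else 0) := by
  simp only [wV, uV, sub_dotProduct, single_dotProduct, Pi.sub_apply, Pi.single_apply, one_mul,
    Fin.castSucc_inj, Fin.succ_inj]
  ring

noncomputable def kM {n : ℕ} (i : Fin n) : Matrix (Fin (n + 1)) (Fin (n + 1)) ℂ[T;T⁻¹] :=
  vecMulVec (uV i) (wV i)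

theorem kM_mul {n : ℕ} (i j : Fin n) :
    kM i * kM j = (wV i ⬝ᵥ uV j) • vecMulVec (uV i) (wV j) := by
  rw [kM, kM, vecMulVec_mul_vecMulVec, vecMulVec_smul]

theorem kM_sq {n : ℕ} (i : Fin n) : kM i * kM i = (s * s + 1) • kM i := by
  rw [kM_mul, w_dot_u, kM]
  congr 1
  simp [Fin.ext_iff]

/-- The matrix of the Burau representation on an Artin generator. -/
noncomputable def burauGen {n : ℕ} (i : Fin n) :
    (Matrix (Fin (n + 1)) (Fin (n + 1)) ℂ[T;T⁻¹])ˣ where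
  val := 1 - kM i
  inv := 1 - (sInv * sInv) • kM i
  val_inv := by
    have h : sInv * sInv * (s * s + 1) = 1 + sInv * sInv := by
      linear_combination (sInv * s + 1) * sInv_mul_s
    rw [sub_mul, mul_sub, mul_sub, one_mul, one_mul, mul_one, mul_smul_comm, kM_sq, smul_smul, h,
      add_smul, one_smul]
    abel
  inv_val := by
    have h : sInv * sInv * (s * s + 1) = 1 + sInv * sInv := by
      linear_combination (sInv * s + 1) * sInv_mul_s
    rw [sub_mul, mul_sub, mul_sub, one_mul, one_mul, mul_one, smul_mul_assoc, kM_sq, smul_smul, h,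
      add_smul, one_smul]
    abel

/-- The (unreduced) Burau representation. -/
noncomputable def burau {n : ℕ} :
    BraidGroup (n + 1) →* (Matrix (Fin (n + 1)) (Fin (n + 1)) ℂ[T;T⁻¹])ˣ :=
  lift burauGen
    (fun i j h => by
      have h1 : wV i ⬝ᵥ uV j = -(s * s) := by
        rw [w_dot_u, if_neg, if_neg, if_pos, if_neg] <;> simp [Fin.ext_iff] <;> omega
      have h2 : wV j ⬝ᵥ uV i = -1 := by
        rw [w_dot_u, if_neg, if_pos, if_neg, if_neg] <;> simp [Fin.ext_iff] <;> omega
      have e1 : kM i * kM j * kM i = (s * s) • kM i := by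
        rw [kM_mul, h1, kM, smul_mul_assoc, vecMulVec_mul_vecMulVec, vecMulVec_smul, h2]
        simp
      have e2 : kM j * kM i * kM j = (s * s) • kM j := by
        rw [kM_mul, h2, kM, smul_mul_assoc, vecMulVec_mul_vecMulVec, vecMulVec_smul, h1]
        simp
      ext1
      show (1 - kM i) * (1 - kM j) * (1 - kM i) = (1 - kM j) * (1 - kM i) * (1 - kM j)
      simp only [sub_mul, mul_sub, one_mul, mul_one, e1, e2, kM_sq, add_smul, one_smul]
      abel)
    (fun i j h => by
      have h1 : wV i ⬝ᵥ uV j = 0 := by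
        rw [w_dot_u, if_neg, if_neg, if_neg, if_neg] <;> simp [Fin.ext_iff] <;> omega
      have h2 : wV j ⬝ᵥ uV i = 0 := by
        rw [w_dot_u, if_neg, if_neg, if_neg, if_neg] <;> simp [Fin.ext_iff] <;> omega
      ext1
      show (1 - kM i) * (1 - kM j) = (1 - kM j) * (1 - kM i)
      simp only [sub_mul, mul_sub, one_mul, mul_one, kM_mul, h1, h2, zero_smul]
      abel)

theorem burau_x {n : ℕ} (i : Fin n) : (burau (x i)).1 = 1 - kM i :=
  congrArg Units.val (lift_x burauGen _ _ i)

theorem burau_x_inv {n : ℕ} (i : Fin n) : (burau (x i)⁻¹).1 = 1 - (sInv * sInv) • kM i := by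
  rw [map_inv]
  exact congrArg (fun u : (Matrix (Fin (n + 1)) (Fin (n + 1)) ℂ[T;T⁻¹])ˣ => (u⁻¹).1)
    (lift_x burauGen _ _ i)

/-- The homomorphism that sends every Artin generator to `s⁻¹`. -/
noncomputable def weight {n : ℕ} : BraidGroup (n + 1) →* ℂ[T;T⁻¹]ˣ :=
  lift (fun _ => ⟨sInv, s, sInv_mul_s, s_mul_sInv⟩) (fun _ _ _ => rfl) (fun _ _ _ => rfl)

theorem weight_x {n : ℕ} (i : Fin n) : (weight (x i)).1 = sInv :=
  congrArg Units.val (lift_x _ _ _ i)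

theorem weight_x_inv {n : ℕ} (i : Fin n) : (weight (x i)⁻¹).1 = s := by
  rw [map_inv]
  exact congrArg (fun u : ℂ[T;T⁻¹]ˣ => (u⁻¹).1) (lift_x _ _ _ i)

theorem burau_mulVec {n : ℕ} (b : BraidGroup (n + 1)) : (burau b).1 *ᵥ 1 = 1 := by
  have hk (i : Fin n) : kM i *ᵥ 1 = 0 := by
    rw [kM, vecMulVec_mulVec]
    simp [wV, sub_dotProduct]
  induction b using braid_induction with
  | h1 => simp
  | hx i b hb =>
    rw [map_mul, Units.val_mul, ← mulVec_mulVec, hb, burau_x, sub_mulVec, hk]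
    simp
  | hx' i b hb =>
    rw [map_mul, Units.val_mul, ← mulVec_mulVec, hb, burau_x_inv, sub_mulVec, smul_mulVec, hk]
    simp

noncomputable def lV (n : ℕ) : Fin (n + 1) → ℂ[T;T⁻¹] := fun j => (s * s) ^ (j : ℕ)

theorem vecMul_burau {n : ℕ} (b : BraidGroup (n + 1)) : lV n ᵥ* (burau b).1 = lV n := by
  have hk (i : Fin n) : lV n ᵥ* kM i = 0 := by
    rw [kM, vecMul_vecMulVec]
    simp [uV, dotProduct_sub, lV, pow_succ]
  induction b using braid_induction with
  | h1 => simp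
  | hx i b hb =>
    rw [map_mul, Units.val_mul, ← vecMul_vecMul, burau_x, vecMul_sub, hk]
    simpa using hb
  | hx' i b hb =>
    rw [map_mul, Units.val_mul, ← vecMul_vecMul, burau_x_inv, vecMul_sub, vecMul_smul, hk]
    simpa using hb

theorem det_bordered {R m : Type} [CommRing R] [Fintype m] [DecidableEq m]
    (M : Matrix (m ⊕ Unit) (m ⊕ Unit) R) (l : m ⊕ Unit → R)
    (h1 : M *ᵥ 1 = 0) (h2 : l ᵥ* M = 0) (hl : l (.inr ()) = 1) :
    (M + vecMulVec 1 l).det = M.toBlocks₁₁.det * (∑ j, l j) ^ 2 := by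
  let col : Matrix m Unit R := of fun _ _ => 1
  let row : Matrix Unit m R := of fun _ j => l (.inl j)
  have hcol : ∀ i, M i (.inr ()) = - ∑ j, M i (.inl j) := by
    intro i
    have := congrFun h1 i
    simp [mulVec, dotProduct] at this
    linear_combination this
  have hrow : ∀ j, M (.inr ()) j = - ∑ i, l (.inl i) * M (.inl i) j := by
    intro j
    have := congrFun h2 j
    simp [vecMul, dotProduct, hl] at this
    linear_combination this
  have hM : M + vecMulVec 1 l = fromBlocks 1 col (-row) 1 * fromBlocks M.toBlocks₁₁ 0 0 1 *
      fromBlocks 1 (-col) row 1 := by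
    simp only [fromBlocks_multiply]
    ext i j
    rcases i with i | ⟨⟩ <;> rcases j with j | ⟨⟩
    · simp [Matrix.add_apply, vecMulVec_apply, Matrix.mul_apply, col, row, toBlocks₁₁]
    · simp [Matrix.add_apply, vecMulVec_apply, Matrix.mul_apply, col, row, toBlocks₁₁, hl, hcol]
    · simp [Matrix.add_apply, vecMulVec_apply, Matrix.mul_apply, col, row, toBlocks₁₁, hrow]
    · simp [Matrix.add_apply, vecMulVec_apply, Matrix.mul_apply, col, row, toBlocks₁₁, hl, hrow,
        hcol]
      simp only [Finset.mul_sum]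
      exact Finset.sum_comm
  have d1 : (fromBlocks 1 col (-row) 1).det = ∑ j, l j := by
    rw [det_fromBlocks_one₁₁]
    simp [Matrix.mul_apply, col, row, hl, add_comm]
  have d2 : (fromBlocks 1 (-col) row 1).det = ∑ j, l j := by
    rw [det_fromBlocks_one₁₁]
    simp [Matrix.mul_apply, col, row, hl, add_comm]
  rw [hM, det_mul, det_mul, d1, d2, det_fromBlocks_zero₂₁]
  simp
  ring

theorem det_affine {R m : Type} [CommRing R] [Fintype m] [DecidableEq m] (D : Matrix m m R)
    (u w : m → R) (c : R) :
    (D + c • vecMulVec u w).det = D.det + c * ((D + vecMulVec u w).det - D.det) := by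
  let U : Matrix m Unit R := of fun i _ => u i
  have key : ∀ c : R, (D + c • vecMulVec u w).det = D.det +
      c * (fromBlocks (0 : Matrix Unit Unit R) (of fun (_ : Unit) j => - w j) U D).det := by
    intro c
    have h := det_fromBlocks_one₁₁ (m := Unit) (n := m) (of fun (_ : Unit) j => - (c * w j)) U D
    have h0 := det_fromBlocks_one₁₁ (m := Unit) (n := m) 0 U D
    have e : D - U * (of fun (_ : Unit) j => - (c * w j)) = D + c • vecMulVec u w := by
      ext i j
      simp [Matrix.mul_apply, vecMulVec_apply, U]
      ring
    have r := det_updateRow_add (fromBlocks (1 : Matrix Unit Unit R) 0 U D)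
      (.inl ()) (Sum.elim (fun _ => 1) (fun _ => 0)) (c • Sum.elim (fun _ => 0) (fun j => - w j))
    rw [det_updateRow_smul] at r
    have r1 : (fromBlocks (1 : Matrix Unit Unit R) 0 U D).updateRow (.inl ())
        (Sum.elim (fun _ => 1) (fun _ => 0) + c • Sum.elim (fun _ => 0) (fun j => - w j)) =
        fromBlocks 1 (of fun (_ : Unit) j => - (c * w j)) U D := by
      ext i j
      rcases i with ⟨⟩ | i <;> rcases j with ⟨⟩ | j <;> simp [updateRow_apply]
    have r2 : (fromBlocks (1 : Matrix Unit Unit R) 0 U D).updateRow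
        (.inl ()) (Sum.elim (fun _ => 1) (fun _ => 0)) = fromBlocks 1 0 U D := by
      ext i j
      rcases i with ⟨⟩ | i <;> rcases j with ⟨⟩ | j <;> simp [updateRow_apply]
    have r3 : (fromBlocks (1 : Matrix Unit Unit R) 0 U D).updateRow
        (.inl ()) (Sum.elim (fun _ => 0) (fun j => - w j)) =
        fromBlocks 0 (of fun (_ : Unit) j => - w j) U D := by
      ext i j
      rcases i with ⟨⟩ | i <;> rcases j with ⟨⟩ | j <;> simp [updateRow_apply]
    rw [r1, r2, r3, h, h0] at r
    rw [← e, r, Matrix.mul_zero, sub_zero]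
  have h1 := key 1
  rw [one_smul] at h1
  rw [key c, h1]
  ring

theorem det_corner {R m : Type} [CommRing R] [Fintype m] [DecidableEq m] (D : Matrix m m R)
    (u w : m → R) (c : R) :
    (fromBlocks (D + c • vecMulVec u w) (of fun i (_ : Unit) => - (c * u i))
      (of fun (_ : Unit) j => - (c * w j)) (of fun _ _ => c)).det = c * D.det := by
  have h : fromBlocks (D + c • vecMulVec u w) (of fun i (_ : Unit) => - (c * u i))
      (of fun (_ : Unit) j => - (c * w j)) (of fun _ _ => c) =
      fromBlocks 1 (of fun i (_ : Unit) => - u i) 0 1 *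
        fromBlocks D 0 (of fun (_ : Unit) j => - (c * w j)) (of fun _ _ => c) := by
    rw [fromBlocks_multiply]
    ext i j
    rcases i with i | ⟨⟩ <;> rcases j with j | ⟨⟩ <;>
      simp [Matrix.mul_apply, vecMulVec_apply] <;> ring
  rw [h, det_mul, det_fromBlocks_zero₂₁, det_fromBlocks_zero₁₂]
  simp [mul_comm]

/-- The principal minor of `1 - A` without the first row and column. -/
noncomputable def minor {n : ℕ} (A : Matrix (Fin (n + 1)) (Fin (n + 1)) ℂ[T;T⁻¹]) : ℂ[T;T⁻¹] :=
  ((1 - A).submatrix Fin.succ Fin.succ).det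

def firstEquiv (n : ℕ) : Fin n ⊕ Unit ≃ Fin (n + 1) :=
  (Equiv.optionEquivSumPUnit (Fin n)).symm.trans (finSuccEquiv n).symm

theorem det_minor {n : ℕ} (A : Matrix (Fin (n + 1)) (Fin (n + 1)) ℂ[T;T⁻¹])
    (h1 : A *ᵥ 1 = 1) (h2 : lV n ᵥ* A = lV n) :
    (1 - A + vecMulVec 1 (lV n)).det = minor A * (∑ j, lV n j) ^ 2 := by
  have := det_bordered ((1 - A).submatrix (firstEquiv n) (firstEquiv n)) (lV n ∘ firstEquiv n)
    (by
      have h : (1 - A) *ᵥ 1 = 0 := by rw [sub_mulVec, h1, one_mulVec, sub_self]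
      have := Matrix.submatrix_mulVec_equiv (1 - A) 1 (firstEquiv n) (firstEquiv n)
      rw [show (1 : Fin n ⊕ Unit → ℂ[T;T⁻¹]) = 1 from rfl]
      rw [show (1 : Fin n ⊕ Unit → ℂ[T;T⁻¹]) ∘ (firstEquiv n).symm = 1 from rfl, h] at this
      exact this)
    (by
      have h : lV n ᵥ* (1 - A) = 0 := by rw [vecMul_sub, h2, vecMul_one, sub_self]
      have := Matrix.submatrix_vecMul_equiv (1 - A) (lV n ∘ firstEquiv n) (firstEquiv n)
        (firstEquiv n)
      rw [Function.comp_assoc, Equiv.self_comp_symm, Function.comp_id, h] at this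
      exact this)
    (by simp [firstEquiv, lV])
  have e1 : (1 - A).submatrix (firstEquiv n) (firstEquiv n) + vecMulVec 1 (lV n ∘ firstEquiv n) =
      (1 - A + vecMulVec 1 (lV n)).submatrix (firstEquiv n) (firstEquiv n) := by
    ext i j; simp [vecMulVec_apply]
  rw [e1, det_submatrix_equiv_self] at this
  rw [this, minor]
  congr 2
  exact Equiv.sum_comp (firstEquiv n) (lV n)

theorem sum_lV_ne_zero (n : ℕ) : ∑ j, lV n j ≠ 0 := by
  intro h
  have := congrArg (LaurentPolynomial.eval₂ (RingHom.id ℂ) (1 : ℂˣ)) h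
  simp [lV, s] at this
  norm_cast at this

theorem minor_comm {n : ℕ} (a b : BraidGroup (n + 1)) :
    minor (burau (a * b)).1 = minor (burau (b * a)).1 := by
  refine mul_right_cancel₀ (pow_ne_zero 2 (sum_lV_ne_zero n)) ?_
  rw [← det_minor _ (burau_mulVec _) (vecMul_burau _),
    ← det_minor _ (burau_mulVec _) (vecMul_burau _)]
  have h : (1 - (burau (a * b)).1 + vecMulVec 1 (lV n)) * (burau a).1 =
      (burau a).1 * (1 - (burau (b * a)).1 + vecMulVec 1 (lV n)) := by
    rw [add_mul, mul_add, vecMulVec_mul, mul_vecMulVec, burau_mulVec, vecMul_burau, sub_mul,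
      mul_sub, ← Units.val_mul, ← Units.val_mul, ← map_mul, ← map_mul, mul_assoc, one_mul,
      mul_one]
  have h' := congrArg Matrix.det h
  rw [det_mul, det_mul, mul_comm] at h'
  have hu : IsUnit ((burau a).1.det) := (Matrix.isUnit_iff_isUnit_det _).1 (burau a).isUnit
  exact hu.mul_left_cancel h'

/-- The Alexander-Conway polynomial of the closure of a braid, computed from its Burau matrix. -/
noncomputable def burauConway {n : ℕ} (b : BraidGroup (n + 1)) : ℂ[T;T⁻¹] :=
  (weight b).1 * s ^ n * minor (burau b).1

theorem burauConway_comm {n : ℕ} (a b : BraidGroup (n + 1)) :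
    burauConway (a * b) = burauConway (b * a) := by
  rw [burauConway, burauConway, minor_comm, map_mul weight, map_mul weight, mul_comm (weight a)]

theorem minor_affine {n : ℕ} (A : Matrix (Fin (n + 1)) (Fin (n + 1)) ℂ[T;T⁻¹]) (i : Fin n)
    (c : ℂ[T;T⁻¹]) :
    minor (A * (1 - c • kM i)) = minor A + c * (minor (A * (1 - kM i)) - minor A) := by
  have h : ∀ c : ℂ[T;T⁻¹], (1 - A * (1 - c • kM i)).submatrix Fin.succ Fin.succ =
      (1 - A).submatrix Fin.succ Fin.succ +
        c • vecMulVec (fun j => (A *ᵥ uV i) j.succ) (fun j => wV i j.succ) := by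
    intro c
    rw [mul_sub, mul_one, mul_smul_comm, kM, mul_vecMulVec]
    ext j l
    simp [vecMulVec_apply]
    ring
  have h1 := h 1
  rw [one_smul, one_smul] at h1
  rw [minor, minor, minor, h c, h1]
  exact det_affine _ _ _ _

theorem burauConway_skein {n : ℕ} (i : Fin n) (a b : BraidGroup (n + 1)) :
    burauConway (a * x i * b) - (sInv - s) * burauConway (a * b)
      - burauConway (a * (x i)⁻¹ * b) = 0 := by
  rw [burauConway_comm _ b, burauConway_comm _ b, burauConway_comm _ b, ← mul_assoc, ← mul_assoc]
  generalize b * a = d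
  simp only [burauConway, map_mul weight, map_mul burau, Units.val_mul, weight_x, weight_x_inv,
    burau_x, burau_x_inv]
  rw [minor_affine _ i (sInv * sInv)]
  generalize minor (burau d).1 = p
  generalize minor ((burau d).1 * (1 - kM i)) = q
  generalize (weight d).1 = e
  linear_combination (e * s ^ n * (p * sInv - q * sInv)) * sInv_mul_s

def lastEquiv (n : ℕ) : Fin n ⊕ Unit ≃ Fin (n + 1) :=
  (Equiv.optionEquivSumPUnit (Fin n)).symm.trans finSuccEquivLast.symm

theorem lastEquiv_symm_castSucc {n : ℕ} (i : Fin n) :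
    (lastEquiv n).symm i.castSucc = .inl i := by
  simp [lastEquiv]

theorem lastEquiv_symm_last {n : ℕ} : (lastEquiv n).symm (Fin.last n) = .inr () := by
  simp [lastEquiv]

/-- Adds a fixed last basis vector to a square matrix. -/
noncomputable def extend {n : ℕ} :
    Matrix (Fin n) (Fin n) ℂ[T;T⁻¹] →* Matrix (Fin (n + 1)) (Fin (n + 1)) ℂ[T;T⁻¹] where
  toFun A := (fromBlocks A 0 0 1).submatrix (lastEquiv n).symm (lastEquiv n).symm
  map_one' := by simp
  map_mul' A B := by rw [submatrix_mul_equiv, fromBlocks_multiply]; simp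

theorem extend_cc {n : ℕ} (A : Matrix (Fin n) (Fin n) ℂ[T;T⁻¹]) (i j : Fin n) :
    extend A i.castSucc j.castSucc = A i j := by
  simp [extend, lastEquiv_symm_castSucc]

theorem extend_cl {n : ℕ} (A : Matrix (Fin n) (Fin n) ℂ[T;T⁻¹]) (i : Fin n) :
    extend A i.castSucc (Fin.last n) = 0 := by
  simp [extend, lastEquiv_symm_castSucc, lastEquiv_symm_last]

theorem extend_lc {n : ℕ} (A : Matrix (Fin n) (Fin n) ℂ[T;T⁻¹]) (i : Fin n) :
    extend A (Fin.last n) i.castSucc = 0 := by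
  simp [extend, lastEquiv_symm_castSucc, lastEquiv_symm_last]

theorem extend_ll {n : ℕ} (A : Matrix (Fin n) (Fin n) ℂ[T;T⁻¹]) :
    extend A (Fin.last n) (Fin.last n) = 1 := by
  simp [extend, lastEquiv_symm_last]

theorem burau_addStrand {n : ℕ} (b : BraidGroup (n + 1)) :
    (burau (addStrand b)).1 = extend (burau b).1 := by
  have : burau.comp addStrand = (Units.map extend).comp (burau (n := n)) := by
    refine hom_ext fun i => ?_
    apply Units.ext
    have hu (j : Fin (n + 1)) : uV i.castSucc j.castSucc = uV i j := by
      simp [uV, Pi.single_apply, ← Fin.castSucc_succ]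
    have hw (j : Fin (n + 1)) : wV i.castSucc j.castSucc = wV i j := by
      simp [wV, Pi.single_apply, ← Fin.castSucc_succ]
    have hu' : uV i.castSucc (Fin.last (n + 1)) = 0 := by
      simp [uV, Pi.single_apply, ← Fin.castSucc_succ, (Fin.castSucc_lt_last _).ne']
    have hw' : wV i.castSucc (Fin.last (n + 1)) = 0 := by
      simp [wV, Pi.single_apply, ← Fin.castSucc_succ, (Fin.castSucc_lt_last _).ne']
    rw [MonoidHom.comp_apply, MonoidHom.comp_apply, addStrand_x, burau_x, Units.coe_map, burau_x]
    refine Matrix.ext fun j l => ?_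
    show _ = extend _ j l
    induction j using Fin.lastCases with
    | last =>
      induction l using Fin.lastCases with
      | last => rw [extend_ll]; simp [kM, vecMulVec_apply, hu']
      | cast l =>
        rw [extend_lc]
        simp [kM, vecMulVec_apply, hu', Matrix.one_apply, (Fin.castSucc_lt_last _).ne']
    | cast j =>
      induction l using Fin.lastCases with
      | last =>
        rw [extend_cl]
        simp [kM, vecMulVec_apply, hw', Matrix.one_apply, (Fin.castSucc_lt_last _).ne]
      | cast l =>
        rw [extend_cc]
        simp [kM, vecMulVec_apply, hu, hw, Matrix.one_apply]
  exact congrArg Units.val (DFunLike.congr_fun this b)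

theorem weight_addStrand {n : ℕ} (b : BraidGroup (n + 1)) : weight (addStrand b) = weight b := by
  have : weight.comp addStrand = weight (n := n) := by
    refine hom_ext fun i => Units.ext ?_
    rw [MonoidHom.comp_apply, addStrand_x, weight_x, weight_x]
  exact DFunLike.congr_fun this b

theorem minor_stab {n : ℕ} (A : Matrix (Fin (n + 1)) (Fin (n + 1)) ℂ[T;T⁻¹]) (c : ℂ[T;T⁻¹]) :
    minor (extend A * (1 - c • kM (Fin.last n))) = c * minor A := by
  have hu : (extend A *ᵥ uV (Fin.last n)) (Fin.last (n + 1)) = -1 := by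
    rw [mulVec, dotProduct, Fin.sum_univ_castSucc]
    simp [extend_lc, extend_ll, uV, Pi.single_apply, (Fin.castSucc_lt_last _).ne']
  have hw : wV (Fin.last n) (Fin.last (n + 1)) = -1 := by
    simp [wV, Pi.single_apply, (Fin.castSucc_lt_last _).ne']
  have := det_corner ((1 - A).submatrix Fin.succ Fin.succ)
    (fun j => (extend A *ᵥ uV (Fin.last n)) j.succ.castSucc)
    (fun j => wV (Fin.last n) j.succ.castSucc) c
  rw [minor, minor, ← this, ← det_submatrix_equiv_self (lastEquiv n).symm]
  congr 1
  rw [mul_sub, mul_one, mul_smul_comm, kM, mul_vecMulVec]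
  refine Matrix.ext fun j l => ?_
  induction j using Fin.lastCases with
  | last =>
    induction l using Fin.lastCases with
    | last => simp [lastEquiv_symm_last, vecMulVec_apply, hu, hw, extend_ll]
    | cast l =>
      simp [lastEquiv_symm_last, lastEquiv_symm_castSucc, vecMulVec_apply, hu, extend_lc,
        Fin.succ_castSucc, Matrix.one_apply, (Fin.castSucc_lt_last _).ne', -Fin.castSucc_succ]
  | cast j =>
    induction l using Fin.lastCases with
    | last =>
      simp [lastEquiv_symm_last, lastEquiv_symm_castSucc, vecMulVec_apply, hw, extend_cl,
        Fin.succ_castSucc, Matrix.one_apply, (Fin.castSucc_lt_last _).ne, -Fin.castSucc_succ]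
    | cast l =>
      simp [lastEquiv_symm_castSucc, vecMulVec_apply, extend_cc,
        Fin.succ_castSucc, Matrix.one_apply, -Fin.castSucc_succ]
      ring

theorem burauConway_stab {n : ℕ} (b : BraidGroup (n + 1)) :
    burauConway (addStrand b * x (Fin.last n)) = burauConway b := by
  have h := minor_stab (burau b).1 1
  rw [one_smul, one_mul] at h
  simp only [burauConway, map_mul weight, map_mul burau, Units.val_mul, weight_x, burau_x,
    burau_addStrand, weight_addStrand, h]
  linear_combination (weight b).1 * s ^ n * minor (burau b).1 * sInv_mul_s

theorem burauConway_stab_inv {n : ℕ} (b : BraidGroup (n + 1)) :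
    burauConway (addStrand b * (x (Fin.last n))⁻¹) = burauConway b := by
  simp only [burauConway, map_mul weight, map_mul burau, Units.val_mul, weight_x_inv,
    burau_x_inv, burau_addStrand, weight_addStrand, minor_stab]
  linear_combination (weight b).1 * s ^ n * minor (burau b).1 * (sInv * s + 1) * sInv_mul_s

/-- The Alexander-Conway polynomial of oriented links exists. -/
theorem exists_isAlexanderConway : ∃ F, IsAlexanderConway F := by
  refine ⟨Quot.lift (fun b => burauConway b.2) ?_, ?_, fun i a b => burauConway_skein i a b⟩
  · rintro _ _ (⟨a, b⟩ | b | b)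
    · exact burauConway_comm a b
    · exact (burauConway_stab b).symm
    · exact (burauConway_stab_inv b).symm
  · show burauConway (1 : BraidGroup 1) = 1
    simp [burauConway, minor]

/-- There is exactly one function on oriented links that is normalized on the unknot and satisfies
the skein relation of the Alexander-Conway polynomial. -/
theorem existsUnique_isAlexanderConway : ∃! F, IsAlexanderConway F := by
  obtain ⟨F, hF⟩ := exists_isAlexanderConway
  exact ⟨F, hF, fun G hG => hG.unique hF⟩

/-- The Alexander-Conway polynomial `∇` of oriented links. -/
noncomputable def nabla : OrientedLink → ℂ[T;T⁻¹] := existsUnique_isAlexanderConway.choose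

theorem nabla_spec : IsAlexanderConway nabla := existsUnique_isAlexanderConway.choose_spec.1

/-! ### The generating functions -/

/-- The braid `x_{i_1}^{a_1} x_{i_2}^{a_2} ⋯ x_{i_k}^{a_k}` on `n + 1` strands. -/
noncomputable def powerBraid {n k : ℕ} (i : Fin k → Fin n) (a : Fin k → ℤ) : BraidGroup (n + 1) :=
  (List.ofFn fun j => x (i j) ^ a j).prod

/-- The Alexander-Conway polynomial of the closure of `x_{i_1}^{a_1} ⋯ x_{i_k}^{a_k}`. -/
noncomputable def nablaPow {n k : ℕ} (i : Fin k → Fin n) (a : Fin k → ℤ) : ℂ[T;T⁻¹] :=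
  nabla (closure (powerBraid i a))

/-- The formal power series `∑ ∇(x_{i_1}^{a_1} ⋯ x_{i_k}^{a_k}) t_1^{a_1} ⋯ t_k^{a_k}`, the sum over
all exponents `a_1, …, a_k ≥ 0`. -/
noncomputable def generatingSeries {n k : ℕ} (i : Fin k → Fin n) :
    MvPowerSeries (Fin k) ℂ[T;T⁻¹] :=
  fun b => nablaPow i fun j => (b j : ℤ)

/-- The sum of the same terms over the exponents with `a_j < 0` for `j ∈ S` and `a_j ≥ 0` for
`j ∉ S`, as a formal power series in `u_j = t_j⁻¹` (`j ∈ S`) and `u_j = t_j` (`j ∉ S`). -/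
noncomputable def orthantSeries {n k : ℕ} (i : Fin k → Fin n) (S : Finset (Fin k)) :
    MvPowerSeries (Fin k) ℂ[T;T⁻¹] :=
  fun b => if ∀ j ∈ S, 0 < b j then nablaPow i fun j => if j ∈ S then -(b j : ℤ) else (b j : ℤ)
    else 0

/-- `q(τ) = (1 + s τ) (1 - s⁻¹ τ)`. -/
noncomputable def q : Polynomial ℂ[T;T⁻¹] :=
  (1 + Polynomial.C s * Polynomial.X) * (1 - Polynomial.C sInv * Polynomial.X)

/-- `Q_0(τ) = 1 - (s⁻¹ - s) τ` and `Q_1(τ) = τ`. -/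
noncomputable def Q : Fin 2 → Polynomial ℂ[T;T⁻¹] :=
  ![1 - Polynomial.C (sInv - s) * Polynomial.X, Polynomial.X]

/-- `p(t_j)` as a formal power series in `t_1, …, t_k`, for a polynomial `p`. -/
noncomputable def at_t {k : ℕ} (j : Fin k) (p : Polynomial ℂ[T;T⁻¹]) :
    MvPowerSeries (Fin k) ℂ[T;T⁻¹] :=
  Polynomial.aeval (MvPowerSeries.X j) p

/-- `p(u_j)` for `j ∉ S`, and `u_j ^ 2 * p(u_j⁻¹)` for `j ∈ S`, for a polynomial `p` of degree at
most `2`; so for `j ∈ S` the ratio of two of these is the ratio of the polynomials in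
`t_j = u_j⁻¹`. -/
noncomputable def at_u {k : ℕ} (S : Finset (Fin k)) (j : Fin k) (p : Polynomial ℂ[T;T⁻¹]) :
    MvPowerSeries (Fin k) ℂ[T;T⁻¹] :=
  Polynomial.aeval (MvPowerSeries.X j) (if j ∈ S then Polynomial.reflect 2 p else p)

end AlexanderConway

/-! With all but one exponent fixed, the skein relation at that crossing says that the invariant, as
a function of the remaining exponent, satisfies `g (a + 2) = z * g (a + 1) + g a` with z = s⁻¹ - s.
The coefficient of `g a` is 1, so the recurrence runs in both directions over any commutative ring.
Its solutions on ℤ are the combinations of two basic ones, fixed by the values at 0 and 1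
(`IsRecurrent.eq_sum`). Applying this to one crossing block after another writes every ∇(x^a) as a
sum over e ∈ {0,1}^k of ∇(x^e) times a product of basic solutions, one for each exponent
(`IsSkein.powerBraid_eq_sum`).

Hence each orthant series is a finite sum of products of one-variable series. The polynomial q = 1 -
zτ - τ² is the reversed characteristic polynomial of the recurrence, so multiplication by q leaves
only boundary terms. For the basic solution number e these are Q_e on the half a ≥ 0. The two-sided
series is formally annihilated by q, so the half a < 0 gives -Q_e (`halfSeries_basicSeq_mul`). Each
index in S thus contributes one sign, whence (-1)^|S|.

The argument uses only the skein relation; Markov invariance and the normalization on the unknot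
play no role. -/

namespace AlexanderConway

open scoped LaurentPolynomial

/-! ### Two-sided sequences with `g (a + 2) = z * g (a + 1) + g a` -/

section Recurrence

variable {R : Type*} [CommRing R]

/-- A two-sided sequence with `g (a + 2) = z * g (a + 1) + g a`. -/
def IsRecurrent (z : R) (g : ℤ → R) : Prop :=
  ∀ a, g (a + 2) = z * g (a + 1) + g a

/-- The companion matrix of the recurrence `g (a + 2) = z * g (a + 1) + g a`. -/
def companion (z : R) : (Matrix (Fin 2) (Fin 2) R)ˣ where
  val := !![0, 1; 1, z]
  inv := !![-z, 1; 1, 0]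
  val_inv := by simp [Matrix.one_fin_two]
  inv_val := by simp [Matrix.one_fin_two]

/-- The two solutions of `g (a + 2) = z * g (a + 1) + g a` with initial values `1, 0` and `0, 1`. -/
def basicSeq (z : R) (e : Fin 2) (a : ℤ) : R := (companion z ^ a).1 0 e

/-- Cayley–Hamilton for the companion matrix M gives M² = zM + 1; multiply by M^a and read off an
entry. Since M is a unit, negative a needs no separate construction. -/
theorem isRecurrent_basicSeq (z : R) (e : Fin 2) : IsRecurrent z (basicSeq z e) := by
  intro a
  have h : (companion z ^ 2).1 = z • (companion z).1 + 1 := by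
    simp [companion, pow_two, Matrix.one_fin_two, add_comm]
  have h2 : (companion z ^ (a + 2)).1 =
      z • (companion z ^ (a + 1)).1 + (companion z ^ a).1 := by
    rw [zpow_add, zpow_add, zpow_one, Units.val_mul, Units.val_mul, zpow_ofNat, h, mul_add,
      mul_smul_comm, mul_one]
  simp [basicSeq, h2]

theorem basicSeq_zero_zero (z : R) : basicSeq z 0 0 = 1 := by simp [basicSeq]

theorem basicSeq_one_zero (z : R) : basicSeq z 1 0 = 0 := by simp [basicSeq]

theorem basicSeq_zero_one (z : R) : basicSeq z 0 1 = 0 := by simp [basicSeq, companion]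

theorem basicSeq_one_one (z : R) : basicSeq z 1 1 = 1 := by simp [basicSeq, companion]

/-- Two neighbouring values determine a solution in both directions, and the two sides agree at 0
and 1. -/
theorem IsRecurrent.eq_sum {z : R} {g : ℤ → R} (hg : IsRecurrent z g) (a : ℤ) :
    g a = ∑ e : Fin 2, basicSeq z e a * g (e : ℕ) := by
  -- Carrying two consecutive values turns the second-order recurrence into an ordinary induction on
  -- ℤ.
  suffices h : ∀ a, g a = basicSeq z 0 a * g 0 + basicSeq z 1 a * g 1 ∧
      g (a + 1) = basicSeq z 0 (a + 1) * g 0 + basicSeq z 1 (a + 1) * g 1 by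
    simpa [Fin.sum_univ_two] using (h a).1
  intro a
  induction a using Int.induction_on with
  | zero =>
    simp [basicSeq_zero_zero, basicSeq_one_zero, basicSeq_zero_one, basicSeq_one_one]
  | succ a ih =>
    refine ⟨ih.2, ?_⟩
    rw [add_assoc, one_add_one_eq_two, hg, isRecurrent_basicSeq z 0, isRecurrent_basicSeq z 1]
    linear_combination z * ih.2 + ih.1
  | pred a ih =>
    -- The recurrence solved backwards, needed for `g` and for both basic sequences.
    have h (g : ℤ → R) (hg : IsRecurrent z g) :
        g (-(a : ℤ) - 1) = g (-a + 1) - z * g (-a) := by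
      have := hg (-(a : ℤ) - 1)
      rw [show -(a : ℤ) - 1 + 2 = -a + 1 by ring, sub_add_cancel] at this
      linear_combination -this
    rw [sub_add_cancel, h g hg, h _ (isRecurrent_basicSeq z 0), h _ (isRecurrent_basicSeq z 1)]
    exact ⟨by linear_combination ih.2 - z * ih.1, ih.1⟩

-- From degree 2 on, the coefficients of the product are exactly the defect of the recurrence, hence
-- zero. Degrees 0 and 1 leave g 0 and g 1 - z g 0.
open PowerSeries in
theorem IsRecurrent.mk_nonneg_mul {z : R} {g : ℤ → R} (hg : IsRecurrent z g) :
    mk (fun m => g m) * (1 - C z * X - X ^ 2) = C (g 0) * (1 - C z * X) + C (g 1) * X := by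
  have h : mk (fun m => g m) * (1 - C z * X - X ^ 2) =
      mk (fun m => g m) - C z * (mk (fun m => g m) * X) - mk (fun m => g m) * X * X := by ring
  have h' : C (g 0) * (1 - C z * X) + C (g 1) * X = C (g 0) + C (g 1 - z * g 0) * X := by
    simp only [map_sub, map_mul]
    ring
  rw [h, h']
  ext m
  rcases m with _ | _ | m
  · simp
  · simp only [map_add, map_sub, coeff_succ_mul_X, coeff_C_mul, coeff_mk, coeff_C]
    simp
  · have := hg m
    simp only [map_add, map_sub, coeff_succ_mul_X, coeff_C_mul, coeff_mk, coeff_C]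
    simp [add_assoc, one_add_one_eq_two, this]

-- In u = t⁻¹ the denominator becomes u²(1 - zu⁻¹ - u⁻²) = u² - zu - 1. The boundary terms at the
-- cut between a = -1 and a = 0 are those of the nonnegative half with the opposite sign, multiplied
-- by u².
open PowerSeries in
theorem IsRecurrent.mk_neg_mul {z : R} {g : ℤ → R} (hg : IsRecurrent z g) :
    mk (fun m => if 0 < m then g (-m) else 0) * (X ^ 2 - C z * X - 1) =
      -(C (g 0) * (X ^ 2 - C z * X) + C (g 1) * X) := by
  set f := mk (fun m => if 0 < m then g (-m) else 0) with hf
  have h : f * (X ^ 2 - C z * X - 1) = f * X * X - C z * (f * X) - f := by ring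
  have h' : -(C (g 0) * (X ^ 2 - C z * X) + C (g 1) * X) =
      C (z * g 0 - g 1) * X - C (g 0) * X * X := by
    simp only [map_sub, map_mul]
    ring
  rw [h, h', hf]
  ext m
  -- The series has no constant term, so degrees 1 and 2 lack the summands in which g 0 would
  -- appear. There the recurrence at -1 and -2 replaces the missing terms by g 0 and g 1; from
  -- degree 3 on it gives cancellation.
  rcases m with _ | _ | _ | m
  · simp
  · have := hg (-1)
    norm_num at this
    simp [coeff_succ_mul_X, this]
  · have := hg (-2)
    norm_num at this
    simp only [map_sub, coeff_succ_mul_X, coeff_C_mul, coeff_mk, coeff_C]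
    simp [this, one_add_one_eq_two, sub_eq_neg_add]
  · have := hg (-(m + 3))
    rw [show -((m : ℤ) + 3) + 2 = -(m + 1) by ring,
      show -((m : ℤ) + 3) + 1 = -(m + 2) by ring] at this
    simp only [map_sub, coeff_succ_mul_X, coeff_C_mul, coeff_mk, coeff_C]
    simp only [Nat.succ_pos, if_true, Nat.cast_add, Nat.cast_one, add_assoc, one_add_one_eq_two, this]
    simp

end Recurrence

/-! ### Products of one-variable series in different variables -/

/-- The factors live in different variables, so a monomial arises in only one way: as the product of
its pure powers. -/
theorem coeff_prod_subst_X {σ R : Type*} [Fintype σ] [CommRing R] (f : σ → PowerSeries R)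
    (b : σ →₀ ℕ) :
    MvPowerSeries.coeff b (∏ j, (f j).subst (MvPowerSeries.X j : MvPowerSeries σ R)) =
      ∏ j, PowerSeries.coeff (b j) (f j) := by
  classical
  let l : σ →₀ σ →₀ ℕ := Finsupp.equivFunOnFinite.symm fun j => Finsupp.single j (b j)
  rw [MvPowerSeries.coeff_prod, Finset.sum_eq_single l]
  · refine Finset.prod_congr rfl fun j _ => ?_
    simp [PowerSeries.coeff_subst_single, l]
  · intro l' hl' hne
    rw [Finset.mem_finsuppAntidiag] at hl'
    by_contra h
    -- A factor in the single variable X j has zero coefficient away from pure powers of X j, so a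
    -- nonzero contribution forces every part of the splitting to be such a power.
    have hs (j : σ) : l' j = Finsupp.single j (l' j j) := by
      by_contra hj
      refine h (Finset.prod_eq_zero (Finset.mem_univ j) ?_)
      rw [PowerSeries.coeff_subst_single, if_neg hj]
    refine hne (Finsupp.ext fun j => ?_)
    have hb : b j = l' j j := by
      rw [← hl'.1, Finsupp.finsetSum_apply, Finset.sum_eq_single j]
      · intro j' _ hj'
        rw [hs j', Finsupp.single_eq_of_ne hj'.symm]
      · simp
    rw [hs j, ← hb]
    rfl
  · intro h
    refine absurd ?_ h
    rw [Finset.mem_finsuppAntidiag]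
    refine ⟨?_, Finset.subset_univ _⟩
    simp [l]

/-! ### Powers of Artin generators -/

/-- Resolve one crossing of x^(a+2): the skein triple has exponents a + 2, a + 1 and a. -/
theorem IsSkein.isRecurrent {n : ℕ} {f : BraidGroup (n + 1) → ℂ[T;T⁻¹]} (hf : IsSkein f)
    (i : Fin n) (b : BraidGroup (n + 1)) : IsRecurrent (sInv - s) fun a => f (x i ^ a * b) := by
  intro a
  have h := hf i (x i ^ (a + 1)) b
  rw [← zpow_add_one, ← zpow_sub_one, add_sub_cancel_right, add_assoc, one_add_one_eq_two] at h
  linear_combination h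

theorem powerBraid_cons {n k : ℕ} (i : Fin (k + 1) → Fin n) (a : Fin (k + 1) → ℤ) :
    powerBraid i a = x (i 0) ^ a 0 * powerBraid (Fin.tail i) (Fin.tail a) := by
  simp [powerBraid, List.ofFn_succ, Fin.tail]

/-- Induction on the number of blocks, expanding the first exponent. It is stated for all skein
functions because the induction hypothesis is applied to a left translate of `f`, which need not be
a link invariant. -/
theorem IsSkein.powerBraid_eq_sum {n k : ℕ} {f : BraidGroup (n + 1) → ℂ[T;T⁻¹]} (hf : IsSkein f)
    (i : Fin k → Fin n) (a : Fin k → ℤ) :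
    f (powerBraid i a) = ∑ e : Fin k → Fin 2, (∏ j, basicSeq (sInv - s) (e j) (a j)) *
      f (powerBraid i fun j => ((e j : ℕ) : ℤ)) := by
  induction k generalizing f with
  | zero => simp [powerBraid]
  | succ k ih =>
    rw [powerBraid_cons, (hf.isRecurrent (i 0) _).eq_sum (a 0),
      ← (Fin.consEquiv fun _ => Fin 2).sum_comp, Fintype.sum_prod_type]
    refine Finset.sum_congr rfl fun e₀ _ => ?_
    have hf' : IsSkein fun b => f (x (i 0) ^ ((e₀ : ℕ) : ℤ) * b) := fun j c d => by
      simpa only [mul_assoc] using hf j (x (i 0) ^ ((e₀ : ℕ) : ℤ) * c) d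
    rw [ih hf', Finset.mul_sum]
    refine Finset.sum_congr rfl fun e _ => ?_
    rw [Fin.prod_univ_succ, powerBraid_cons]
    simp [Fin.consEquiv, Fin.tail_def, mul_assoc]

theorem isSkein_nabla (n : ℕ) : IsSkein fun b : BraidGroup (n + 1) => nabla (closure b) :=
  fun i a b => nabla_spec.skein i a b

theorem nablaPow_eq_sum {n k : ℕ} (i : Fin k → Fin n) (a : Fin k → ℤ) :
    nablaPow i a = ∑ e : Fin k → Fin 2, (∏ j, basicSeq (sInv - s) (e j) (a j)) *
      nablaPow i fun j => ((e j : ℕ) : ℤ) :=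
  (isSkein_nabla n).powerBraid_eq_sum i a

/-! ### The series of an orthant -/

/-- The expanded form matches q with the recurrence for z = s⁻¹ - s; the quadratic coefficient is -s
s⁻¹ = -1. -/
theorem q_eq : q = 1 - Polynomial.C (sInv - s) * Polynomial.X - Polynomial.X ^ 2 := by
  have h : (Polynomial.C s * Polynomial.C sInv : Polynomial ℂ[T;T⁻¹]) = 1 := by
    rw [← map_mul, s_mul_sInv, map_one]
  rw [q, map_sub]
  linear_combination -Polynomial.X ^ 2 * h

theorem reflect_X : Polynomial.reflect 2 (Polynomial.X : Polynomial ℂ[T;T⁻¹]) = Polynomial.X := by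
  simpa [Polynomial.revAt_le] using Polynomial.reflect_monomial (R := ℂ[T;T⁻¹]) 2 1

theorem reflect_q : Polynomial.reflect 2 q =
    Polynomial.X ^ 2 - Polynomial.C (sInv - s) * Polynomial.X - 1 := by
  rw [q_eq, Polynomial.reflect_sub, Polynomial.reflect_sub, Polynomial.reflect_one,
    Polynomial.reflect_C_mul, reflect_X, Polynomial.reflect_monomial, Polynomial.revAt_le le_rfl]
  simp

theorem reflect_Q_zero : Polynomial.reflect 2 (Q 0) =
    Polynomial.X ^ 2 - Polynomial.C (sInv - s) * Polynomial.X := by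
  show Polynomial.reflect 2 (1 - Polynomial.C (sInv - s) * Polynomial.X) = _
  rw [Polynomial.reflect_sub, Polynomial.reflect_one, Polynomial.reflect_C_mul, reflect_X]

/-- This form lets identities between one-variable power series be transported to the variable with
index `j`. -/
theorem at_u_eq_subst {k : ℕ} (S : Finset (Fin k)) (j : Fin k) (p : Polynomial ℂ[T;T⁻¹]) :
    at_u S j p = PowerSeries.subst (MvPowerSeries.X j : MvPowerSeries (Fin k) ℂ[T;T⁻¹])
      ((if j ∈ S then Polynomial.reflect 2 p else p : Polynomial ℂ[T;T⁻¹]) :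
        PowerSeries ℂ[T;T⁻¹]) := by
  rw [← PowerSeries.coe_substAlgHom (PowerSeries.HasSubst.X j), PowerSeries.substAlgHom_coe, at_u]

/-- The constant term is 1, or, after reflection, the leading coefficient -1 of q. -/
theorem isUnit_at_u_q {k : ℕ} (S : Finset (Fin k)) (j : Fin k) : IsUnit (at_u S j q) := by
  rw [MvPowerSeries.isUnit_iff_constantCoeff, at_u]
  split_ifs
  · rw [reflect_q]; simp
  · rw [q_eq]; simp

/-- The sum of `g a * t ^ a` over `a < 0` (for `neg` true) in powers of `t⁻¹`, or over `a ≥ 0` in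
powers of `t`. -/
noncomputable def halfSeries (neg : Prop) [Decidable neg] (g : ℤ → ℂ[T;T⁻¹]) :
    PowerSeries ℂ[T;T⁻¹] :=
  if neg then PowerSeries.mk fun m => if 0 < m then g (-m) else 0
  else PowerSeries.mk fun m => g m

/-- The initial values (1, 0) and (0, 1) turn the boundary terms into Q_0 and Q_1. On the negative
half, q and Q_e are reflected in the same degree 2, so their ratio is unchanged and only the sign
remains. -/
theorem halfSeries_basicSeq_mul (neg : Prop) [Decidable neg] (e : Fin 2) :
    halfSeries neg (basicSeq (sInv - s) e) *
        ((if neg then Polynomial.reflect 2 q else q : Polynomial ℂ[T;T⁻¹]) :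
          PowerSeries ℂ[T;T⁻¹]) =
      (if neg then -1 else 1) *
        ((if neg then Polynomial.reflect 2 (Q e) else Q e : Polynomial ℂ[T;T⁻¹]) :
          PowerSeries ℂ[T;T⁻¹]) := by
  have hr := isRecurrent_basicSeq (sInv - s) e
  have hQ1 : Q 1 = Polynomial.X := rfl
  have hQ0 : Q 0 = 1 - Polynomial.C (sInv - s) * Polynomial.X := rfl
  rw [halfSeries]
  split_ifs
  · have h := hr.mk_neg_mul
    rw [reflect_q]
    push_cast
    rw [h]
    fin_cases e
    · simp [reflect_Q_zero, basicSeq_zero_zero, basicSeq_zero_one]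
    · simp [hQ1, reflect_X, basicSeq_one_zero, basicSeq_one_one]
  · have h := hr.mk_nonneg_mul
    rw [q_eq]
    push_cast
    rw [h]
    fin_cases e
    · simp [hQ0, basicSeq_zero_zero, basicSeq_zero_one]
    · simp [hQ1, basicSeq_one_zero, basicSeq_one_one]

theorem prod_halfSeries_mul {k : ℕ} (S : Finset (Fin k)) (e : Fin k → Fin 2) :
    (∏ j, (halfSeries (j ∈ S) (basicSeq (sInv - s) (e j))).subst
        (MvPowerSeries.X j : MvPowerSeries (Fin k) ℂ[T;T⁻¹])) * ∏ j, at_u S j q =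
      (-1) ^ S.card * ∏ j, at_u S j (Q (e j)) := by
  -- Distributes the global sign over the variables, so that the identity can be checked factor by
  -- factor.
  have hS : (-1 : MvPowerSeries (Fin k) ℂ[T;T⁻¹]) ^ S.card = ∏ j, if j ∈ S then -1 else 1 := by
    simp
  rw [hS, ← Finset.prod_mul_distrib, ← Finset.prod_mul_distrib]
  refine Finset.prod_congr rfl fun j _ => ?_
  rw [at_u_eq_subst, at_u_eq_subst, ← PowerSeries.subst_mul (PowerSeries.HasSubst.X j),
    halfSeries_basicSeq_mul, PowerSeries.subst_mul (PowerSeries.HasSubst.X j)]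
  congr 1
  rw [← PowerSeries.coe_substAlgHom (PowerSeries.HasSubst.X j)]
  split_ifs <;> simp

/-- Separation of variables: the expansion of ∇(x^a) over {0,1}^k, read coefficient by coefficient.
-/
theorem orthantSeries_eq_sum {n k : ℕ} (i : Fin k → Fin n) (S : Finset (Fin k)) :
    orthantSeries i S = ∑ e : Fin k → Fin 2,
      (∏ j, (halfSeries (j ∈ S) (basicSeq (sInv - s) (e j))).subst
        (MvPowerSeries.X j : MvPowerSeries (Fin k) ℂ[T;T⁻¹])) *
        MvPowerSeries.C (nablaPow i fun j => ((e j : ℕ) : ℤ)) := by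
  ext1 b
  rw [map_sum]
  simp only [MvPowerSeries.coeff_mul_C, coeff_prod_subst_X]
  show (if ∀ j ∈ S, 0 < b j then _ else _) = _
  split_ifs with h
  · rw [nablaPow_eq_sum]
    refine Finset.sum_congr rfl fun e _ => congrArg (· * _) (Finset.prod_congr rfl fun j _ => ?_)
    rw [halfSeries]
    split_ifs with hj
    · simp [h j hj]
    · simp
  -- A zero exponent in a variable of `S` lies outside the orthant; the negative half-series in that
  -- variable has no constant term, so every product vanishes too.
  · push Not at h
    obtain ⟨j, hj, hb⟩ := h
    refine (Finset.sum_eq_zero fun e _ => ?_).symm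
    rw [Finset.prod_eq_zero (Finset.mem_univ j), zero_mul]
    simp [halfSeries, hj, Nat.le_zero.1 hb]

theorem orthantSeries_eq {n k : ℕ} (i : Fin k → Fin n) (S : Finset (Fin k)) :
    orthantSeries i S = (-1) ^ S.card * ((∏ j, Ring.inverse (at_u S j q)) *
      ∑ e : Fin k → Fin 2, (∏ j, at_u S j (Q (e j))) *
        MvPowerSeries.C (nablaPow i fun j => ((e j : ℕ) : ℤ))) := by
  -- `Ring.inverse` is a genuine inverse only on units, hence the appeal to `isUnit_at_u_q`.
  have hinv : (∏ j, at_u S j q) * ∏ j, Ring.inverse (at_u S j q) = 1 := by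
    rw [← Finset.prod_mul_distrib]
    exact Finset.prod_eq_one fun j _ => Ring.mul_inverse_cancel _ (isUnit_at_u_q S j)
  rw [orthantSeries_eq_sum, Finset.mul_sum, Finset.mul_sum]
  refine Finset.sum_congr rfl fun e _ => ?_
  linear_combination (∏ j, Ring.inverse (at_u S j q)) *
    MvPowerSeries.C (nablaPow i fun j => ((e j : ℕ) : ℤ)) * prod_halfSeries_mul S e -
    (∏ j, (halfSeries (j ∈ S) (basicSeq (sInv - s) (e j))).subst
        (MvPowerSeries.X j : MvPowerSeries (Fin k) ℂ[T;T⁻¹])) *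
        MvPowerSeries.C (nablaPow i fun j => ((e j : ℕ) : ℤ)) * hinv

theorem at_u_empty {k : ℕ} (j : Fin k) (p : Polynomial ℂ[T;T⁻¹]) : at_u ∅ j p = at_t j p := by
  simp [at_u, at_t]

theorem orthantSeries_empty {n k : ℕ} (i : Fin k → Fin n) :
    orthantSeries i ∅ = generatingSeries i := by
  funext b
  simp [orthantSeries, generatingSeries]

end AlexanderConway

theorem theorem1p6 (n k : ℕ) (i : Fin k → Fin n) :
    ((∀ j : Fin k, IsUnit (AlexanderConway.at_t j AlexanderConway.q)) ∧
      AlexanderConway.generatingSeries i =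
        (∏ j : Fin k, Ring.inverse (AlexanderConway.at_t j AlexanderConway.q)) *
          ∑ e : Fin k → Fin 2, (∏ j : Fin k, AlexanderConway.at_t j (AlexanderConway.Q (e j))) *
            MvPowerSeries.C (AlexanderConway.nablaPow i fun j => ((e j : ℕ) : ℤ))) ∧
    ∀ S : Finset (Fin k),
      (∀ j : Fin k, IsUnit (AlexanderConway.at_u S j AlexanderConway.q)) ∧
      AlexanderConway.orthantSeries i S =
        (-1) ^ S.card *
          ((∏ j : Fin k, Ring.inverse (AlexanderConway.at_u S j AlexanderConway.q)) *
            ∑ e : Fin k → Fin 2,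
              (∏ j : Fin k, AlexanderConway.at_u S j (AlexanderConway.Q (e j))) *
                MvPowerSeries.C (AlexanderConway.nablaPow i fun j => ((e j : ℕ) : ℤ))) := by
  refine ⟨⟨fun j => ?_, ?_⟩, fun S =>
    ⟨AlexanderConway.isUnit_at_u_q S, AlexanderConway.orthantSeries_eq i S⟩⟩
  · rw [← AlexanderConway.at_u_empty]
    exact AlexanderConway.isUnit_at_u_q ∅ j
  -- The series over nonnegative exponents is the case S = ∅: nothing is reflected and the sign is
  -- 1.
  · rw [← AlexanderConway.orthantSeries_empty, AlexanderConway.orthantSeries_eq]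
    simp [AlexanderConway.at_u_empty]
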